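/- Let $\mathbb{T}$ be the unit circle with normalized Lebesgue measure $m$ and $L^p=L^p(\mathbb{T},m)$. For $1\le p\le\infty$ let $H^p$ be the Hardy space, identified via radial limits with the space of all $f\in L^p$ whose Fourier coefficients $\hat f(n)$ vanish for all $n<0$. Let $\Theta$ be an inner function, that is, a bounded analytic function on the unit disc whose radial limits exist and have modulus one almost everywhere on $\mathbb{T}$; its boundary function is again denoted by $\Theta$. Let $K_\Theta=H^2\ominus\Theta H^2$ and let $P_\Theta$ be the orthogonal projection of $L^2$ onto $K_\Theta$. For $\phi\in L^2$ the truncated Toeplitz operator $A_\phi=A_\phi^\Theta$ is the operator on $K_\Theta$ with domain $K_\Theta\cap H^\infty$ given by $A_\phi f=P_\Theta(\phi f)$; it is called compact if it extends to a compact bounded operator on all of $K_\Theta$. Let $\mathbf{C}(\mathbb{T})$ be the space of continuous complex functions on $\mathbb{T}$, and for sums of function spaces write, e.g., $\Theta\mathbf{C}(\mathbb{T})+\Theta H^\infty=\{\Theta c+\Theta h: c\in\mathbf{C}(\mathbb{T}),\ h\in H^\infty\}$ (functions equal almost everywhere are identified). Let $\phi\in L^2$. Then: (i) If $\phi\in\Theta\mathbf{C}(\mathbb{T})+\Theta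 H^\infty$, then $A_\phi$ is compact. (ii) If $\phi\in\mathbf{C}(\mathbb{T})+H^\infty$ and $A_\phi$ is compact, then $\phi\in\Theta\mathbf{C}(\mathbb{T})+\Theta H^\infty$. -/

import Mathlib

open MeasureTheory Filter Topology
open scoped ENNReal

noncomputable section

namespace TTO

/-- The unit circle `𝕋`, parametrised by `x ↦ e^{ix}` (`AddCircle.toCircle`), `x ∈ ℝ / 2πℤ`. -/
abbrev 𝕋 : Type := AddCircle (2 * Real.pi)

instance factTwoPiPos : Fact (0 < 2 * Real.pi) := ⟨Real.two_pi_pos⟩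

/-- Normalised Lebesgue measure on the circle. -/
abbrev m : Measure 𝕋 := AddCircle.haarAddCircle

/-- `L^p` of the circle. -/
abbrev L (p : ℝ≥0∞) : Type := Lp ℂ p m

lemma integrable_of_L {p : ℝ≥0∞} (hp : 1 ≤ p) (f : L p) : Integrable f m :=
  (Lp.memLp f).integrable hp

/-- The Hardy space `H^p` (`1 ≤ p ≤ ∞`), as a subspace of `L^p` of the circle: the functions whose
Fourier coefficients of negative index vanish. -/
def hardy (p : ℝ≥0∞) [hp : Fact (1 ≤ p)] : Submodule ℂ (L p) where
  carrier := {f | ∀ n : ℤ, n < 0 → fourierCoeff (f : 𝕋 → ℂ) n = 0}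
  zero_mem' := by
    intro n _
    have h : fourierCoeff ((0 : L p) : 𝕋 → ℂ) n = ∫ _ : 𝕋, (0 : ℂ) ∂m := by
      refine integral_congr_ae ?_
      filter_upwards [] with x
      simp
    simpa using h
  add_mem' := by
    intro f g hf hg n hn
    have h : fourierCoeff ((f + g : L p) : 𝕋 → ℂ) n =
        fourierCoeff ((f : 𝕋 → ℂ) + (g : 𝕋 → ℂ)) n := by
      refine integral_congr_ae ?_
      filter_upwards [Lp.coeFn_add f g] with x hx
      rw [hx]
    rw [h, fourierCoeff.add (integrable_of_L hp.out f) (integrable_of_L hp.out g)]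
    simp [hf n hn, hg n hn]
  smul_mem' := by
    intro c f hf n hn
    have h : fourierCoeff ((c • f : L p) : 𝕋 → ℂ) n = fourierCoeff (c • (f : 𝕋 → ℂ)) n := by
      refine integral_congr_ae ?_
      filter_upwards [Lp.coeFn_smul c f] with x hx
      rw [hx]
    rw [h, fourierCoeff.const_smul, hf n hn, smul_zero]

lemma isClosed_hardy_two : IsClosed (hardy 2 : Set (L 2)) := by
  have h : (hardy 2 : Set (L 2)) =
      ⋂ n : ℤ, ⋂ _ : n < 0, {f : L 2 | fourierBasis.repr f n = 0} := by
    ext f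
    simp [hardy, fourierBasis_repr]
  rw [h]
  refine isClosed_iInter fun n => isClosed_iInter fun _ => isClosed_eq ?_ continuous_const
  have h2 : (fun f : L 2 => fourierBasis.repr f n) =
      fun f : L 2 => inner ℂ (fourierBasis n) f := by
    ext f
    rw [HilbertBasis.repr_apply_apply]
  rw [h2]
  fun_prop

/-- Inner functions: bounded analytic functions on the open unit disc whose radial limits exist and
have modulus one almost everywhere on the circle. -/
structure IsInner (Θ : ℂ → ℂ) : Prop where
  analytic : DifferentiableOn ℂ Θ (Metric.ball 0 1)
  bounded : ∃ C : ℝ, ∀ z ∈ Metric.ball (0 : ℂ) 1, ‖Θ z‖ ≤ C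
  radial : ∀ᵐ x ∂m, ∃ w : ℂ, ‖w‖ = 1 ∧
    Tendsto (fun r : ℝ => Θ (r * (AddCircle.toCircle x : ℂ))) (𝓝[<] 1) (𝓝 w)

/-- The boundary function `x ↦ lim_{r → 1⁻} Θ (r e^{ix})` on the circle. -/
def boundary (Θ : ℂ → ℂ) (x : 𝕋) : ℂ :=
  limUnder (𝓝[<] (1 : ℝ)) (fun r : ℝ => Θ (r * (AddCircle.toCircle x : ℂ)))

/-- The subspace `Θ H²` of `L²`. -/
def shiftInvariant (Θ : ℂ → ℂ) : Submodule ℂ (L 2) where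
  carrier := {f | ∃ g ∈ hardy 2, (f : 𝕋 → ℂ) =ᵐ[m] fun x => boundary Θ x * g x}
  zero_mem' := by
    refine ⟨0, zero_mem _, ?_⟩
    filter_upwards [] with x
    simp
  add_mem' := by
    rintro f₁ f₂ ⟨g₁, hg₁, h₁⟩ ⟨g₂, hg₂, h₂⟩
    refine ⟨g₁ + g₂, add_mem hg₁ hg₂, ?_⟩
    filter_upwards [h₁, h₂, Lp.coeFn_add f₁ f₂, Lp.coeFn_add g₁ g₂] with x a b c d
    rw [c, d, Pi.add_apply, Pi.add_apply, a, b, mul_add]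
  smul_mem' := by
    rintro c f ⟨g, hg, h⟩
    refine ⟨c • g, Submodule.smul_mem _ c hg, ?_⟩
    filter_upwards [h, Lp.coeFn_smul c f, Lp.coeFn_smul c g] with x a b d
    rw [b, d, Pi.smul_apply, Pi.smul_apply, a, smul_eq_mul, smul_eq_mul]
    ring

/-- The model space `K_Θ = H² ⊖ Θ H²`. -/
def modelSpace (Θ : ℂ → ℂ) : Submodule ℂ (L 2) :=
  hardy 2 ⊓ (shiftInvariant Θ)ᗮ

lemma isClosed_modelSpace (Θ : ℂ → ℂ) : IsClosed (modelSpace Θ : Set (L 2)) :=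
  isClosed_hardy_two.inter (Submodule.isClosed_orthogonal _)

instance (Θ : ℂ → ℂ) : CompleteSpace (modelSpace Θ) :=
  (isClosed_modelSpace Θ).completeSpace_coe

/-- `K_Θ ∩ H^∞`, as a subspace of `K_Θ`. Its elements are already in `H²`, so only essential
boundedness has to be required. -/
def boundedPart (Θ : ℂ → ℂ) : Submodule ℂ (modelSpace Θ) where
  carrier := {f | MemLp ((f : L 2) : 𝕋 → ℂ) ∞ m}
  zero_mem' := (memLp_congr_ae (Lp.coeFn_zero ℂ 2 m)).2 MemLp.zero
  add_mem' := by
    intro f g hf hg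
    exact (memLp_congr_ae (Lp.coeFn_add (f : L 2) (g : L 2))).2 (hf.add hg)
  smul_mem' := by
    intro c f hf
    exact (memLp_congr_ae (Lp.coeFn_smul c (f : L 2))).2 (hf.const_smul c)

lemma memLp_symbol_mul {Θ : ℂ → ℂ} (φ : L 2) (f : boundedPart Θ) :
    MemLp (fun x => φ x * ((f : modelSpace Θ) : L 2) x) 2 m :=
  MemLp.mul f.2 (Lp.memLp φ)

/-- The truncated Toeplitz operator `A_φ` with symbol `φ ∈ L²`: the densely defined operator on
`K_Θ` with domain `K_Θ ∩ H^∞` given by `A_φ f = P_Θ (φ f)`. -/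
def tto (Θ : ℂ → ℂ) (φ : L 2) : modelSpace Θ →ₗ.[ℂ] modelSpace Θ where
  domain := boundedPart Θ
  toFun :=
    { toFun := fun f => (modelSpace Θ).orthogonalProjectionOnto ((memLp_symbol_mul φ f).toLp _)
      map_add' := by
        intro f g
        rw [← map_add, ← MemLp.toLp_add]
        congr 1
        refine MemLp.toLp_congr _ _ ?_
        filter_upwards [Lp.coeFn_add ((f : modelSpace Θ) : L 2) ((g : modelSpace Θ) : L 2)]
          with x hx
        simp only [Submodule.coe_add, Pi.add_apply] at hx ⊢
        rw [hx, mul_add]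
      map_smul' := by
        intro c f
        rw [RingHom.id_apply, ← map_smul, ← MemLp.toLp_const_smul]
        congr 1
        refine MemLp.toLp_congr _ _ ?_
        filter_upwards [Lp.coeFn_smul c ((f : modelSpace Θ) : L 2)] with x hx
        simp only [Submodule.coe_smul, Pi.smul_apply, smul_eq_mul] at hx ⊢
        rw [hx]
        ring }

/-- A densely defined operator on `K_Θ` is compact when it extends to a bounded operator on `K_Θ`
which is compact. -/
def ExtendsCompactly {Θ : ℂ → ℂ} (A : modelSpace Θ →ₗ.[ℂ] modelSpace Θ) : Prop :=
  ∃ B : modelSpace Θ →L[ℂ] modelSpace Θ,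
    IsCompactOperator B ∧ ∀ f : A.domain, B (f : modelSpace Θ) = A f

/-- `C(𝕋) + H^∞`, inside `L²`. -/
def contAddHInf : Set (L 2) :=
  {φ | ∃ c : C(𝕋, ℂ), ∃ h ∈ hardy ∞, (φ : 𝕋 → ℂ) =ᵐ[m] fun x => c x + h x}

/-- `Θ C(𝕋) + Θ H^∞`, inside `L²`. -/
def innerMulContAddHInf (Θ : ℂ → ℂ) : Set (L 2) :=
  {φ | ∃ c : C(𝕋, ℂ), ∃ h ∈ hardy ∞,
    (φ : 𝕋 → ℂ) =ᵐ[m] fun x => boundary Θ x * c x + boundary Θ x * h x}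

end TTO

end

/-! Write P for the projection onto H² and H_a f = (I - P)(a P f) for the Hankel operator. Both
halves reduce to Hankel operators through P_Θ = P - ΘPΘ̄, equivalently Θ(I - P)Θ̄ = P_Θ + (I - P).
For (i), P_Θ kills ΘH², so A_φ with φ = Θ(c + h) is P_Θ Θ H_{c+h} on K_Θ; here H_h = 0, and H_c is a
norm limit of finite-rank operators. For (ii), splitting Pf along H² = K_Θ ⊕ ΘH² expresses H_{Θ̄φ}
through A_φ and H_φ, both compact. Hartman's theorem then puts Θ̄φ in C(𝕋) + H^∞, and multiplying by
Θ finishes.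

Hartman's theorem follows from Nehari's. Since (I - P)z^N tends strongly to 0, compactness of H_ψ
makes the Hankel operator of z^N ψ small in norm, so ψ is a uniform limit of elements of the spaces
z^{-N} H^∞ (`mem_closure_finiteNeg`). Fejér means split such elements into C(𝕋) + H^∞ with a bound
independent of N (`exists_cont_add_hardy`), and this passes to the closure.

Nehari's theorem is Hahn–Banach plus the duality of L¹ and L^∞. Only polynomials need the H¹
factorization p = FG with |F| = |G| on the circle, and it is built root by root. -/

noncomputable section

namespace TTO

/-! ### Multiplication operators and Fourier coefficients -/

/-- The operator of multiplication by an essentially bounded function, on `L²`. -/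
def mulL : L ∞ →L[ℂ] L 2 →L[ℂ] L 2 :=
  (ContinuousLinearMap.mul ℂ ℂ).holderL m ∞ 2 2

lemma coeFn_mulL (a : L ∞) (f : L 2) : (mulL a f : 𝕋 → ℂ) =ᵐ[m] fun x => a x * f x :=
  (ContinuousLinearMap.mul ℂ ℂ).coeFn_holder a f

lemma norm_mulL_apply_le (a : L ∞) (f : L 2) : ‖mulL a f‖ ≤ ‖a‖ * ‖f‖ := by
  refine ((ContinuousLinearMap.mul ℂ ℂ).norm_holder_apply_apply_le a f).trans ?_
  gcongr
  simp

/-- A continuous function, as an element of `L^p`. -/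
abbrev contL (p : ℝ≥0∞) [Fact (1 ≤ p)] : C(𝕋, ℂ) →L[ℂ] L p := ContinuousMap.toLp p m ℂ

lemma coeFn_contL (p : ℝ≥0∞) [Fact (1 ≤ p)] (c : C(𝕋, ℂ)) : (contL p c : 𝕋 → ℂ) =ᵐ[m] c :=
  ContinuousMap.coeFn_toLp m c

lemma norm_contL_le (p : ℝ≥0∞) [Fact (1 ≤ p)] (c : C(𝕋, ℂ)) : ‖contL p c‖ ≤ ‖c‖ := by
  simpa [measureUnivNNReal] using
    (contL p).le_of_opNorm_le (ContinuousMap.toLp_norm_le (p := p) m) c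

lemma inner_mulL_star (a : L ∞) (f g : L 2) :
    inner ℂ (mulL (star a) f) g = inner ℂ f (mulL a g) := by
  rw [L2.inner_def, L2.inner_def]
  refine integral_congr_ae ?_
  filter_upwards [coeFn_mulL (star a) f, coeFn_mulL a g, Lp.coeFn_star a] with x h1 h2 h3
  simp only [h1, h2, h3, Pi.star_apply, RCLike.inner_apply, map_mul]
  simp
  ring

lemma mulL_comm (a b : L ∞) (f : L 2) : mulL a (mulL b f) = mulL b (mulL a f) := by
  refine Lp.ext ?_
  filter_upwards [coeFn_mulL a (mulL b f), coeFn_mulL b (mulL a f), coeFn_mulL a f,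
    coeFn_mulL b f] with x h1 h2 h3 h4
  rw [h1, h2, h3, h4]
  ring

lemma inner_fourier (f : L 2) (n : ℤ) :
    inner ℂ (contL 2 (fourier n)) f = fourierCoeff (f : 𝕋 → ℂ) n := by
  rw [← fourierBasis_repr, HilbertBasis.repr_apply_apply, coe_fourierBasis]

lemma fourierCoeff_fourier_mul (f : 𝕋 → ℂ) (k n : ℤ) :
    fourierCoeff (fun x => fourier k x * f x) n = fourierCoeff f (n - k) := by
  refine integral_congr_ae (Eventually.of_forall fun x => ?_)
  simp only [smul_eq_mul]
  rw [← mul_assoc, ← fourier_add]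
  congr 3
  ring

lemma fourierCoeff_conj (f : 𝕋 → ℂ) (n : ℤ) :
    fourierCoeff (fun x => starRingEnd ℂ (f x)) n = starRingEnd ℂ (fourierCoeff f (-n)) := by
  rw [fourierCoeff, fourierCoeff, ← integral_conj]
  refine integral_congr_ae (Eventually.of_forall fun x => ?_)
  simp

lemma fourierCoeff_mulL_fourier (f : L 2) (k n : ℤ) :
    fourierCoeff (mulL (contL ∞ (fourier k)) f : 𝕋 → ℂ) n =
      fourierCoeff (f : 𝕋 → ℂ) (n - k) := by
  rw [← fourierCoeff_fourier_mul]
  refine congrFun (fourierCoeff_congr_ae ?_) n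
  filter_upwards [coeFn_mulL (contL ∞ (fourier k)) f, coeFn_contL ∞ (fourier k)] with x h1 h2
  rw [h1, h2]

lemma fourierCoeff_contL_fourier (p : ℝ≥0∞) [Fact (1 ≤ p)] (k n : ℤ) :
    fourierCoeff (contL p (fourier k) : 𝕋 → ℂ) n = if n = k then 1 else 0 := by
  rw [fourierCoeff_congr_ae (coeFn_contL p (fourier k)), fourierCoeff_fourier]
  simp [Pi.single_apply]

/-! ### The projection onto H² -/

instance : CompleteSpace (hardy 2) := isClosed_hardy_two.completeSpace_coe

lemma mem_hardy {p : ℝ≥0∞} [Fact (1 ≤ p)] {f : L p} :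
    f ∈ hardy p ↔ ∀ n : ℤ, n < 0 → fourierCoeff (f : 𝕋 → ℂ) n = 0 := Iff.rfl

lemma mem_hardy_orthogonal {g : L 2} :
    g ∈ (hardy 2)ᗮ ↔ ∀ n : ℤ, 0 ≤ n → fourierCoeff (g : 𝕋 → ℂ) n = 0 := by
  constructor
  · intro hg n hn
    rw [← inner_fourier]
    refine (Submodule.mem_orthogonal _ _).1 hg _ fun k hk => ?_
    rw [fourierCoeff_contL_fourier, if_neg (by omega)]
  · intro h
    rw [Submodule.mem_orthogonal]
    intro f hf
    rw [← fourierBasis.tsum_inner_mul_inner f g]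
    refine (tsum_congr fun n => ?_).trans tsum_zero
    rw [coe_fourierBasis]
    rcases lt_or_ge n 0 with hn | hn
    · rw [← inner_conj_symm, inner_fourier, hf n hn]
      simp
    · rw [inner_fourier g n, h n hn, mul_zero]

/-- The orthogonal projection of `L²` onto `H²`. -/
abbrev projH : L 2 →L[ℂ] L 2 := (hardy 2).starProjection

/-- The orthogonal projection of `L²` onto the orthogonal complement of `H²`. -/
def projHc : L 2 →L[ℂ] L 2 := ContinuousLinearMap.id ℂ (L 2) - projH

lemma projHc_apply (f : L 2) : projHc f = f - projH f := rfl

lemma projHc_mem (f : L 2) : projHc f ∈ (hardy 2)ᗮ :=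
  Submodule.sub_starProjection_mem_orthogonal f

lemma projHc_eq_zero {f : L 2} (hf : f ∈ hardy 2) : projHc f = 0 := by
  rw [projHc_apply, Submodule.starProjection_eq_self_iff.2 hf, sub_self]

lemma projH_eq {f g : L 2} (hg : g ∈ hardy 2) (h : f - g ∈ (hardy 2)ᗮ) : projH f = g :=
  (Submodule.eq_starProjection_of_mem_orthogonal hg h)

lemma norm_projHc_le (f : L 2) : ‖projHc f‖ ≤ ‖f‖ := by
  have := (hardy 2)ᗮ.norm_starProjection_apply_le f
  rwa [Submodule.starProjection_orthogonal_val] at this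

/-- By duality: for n < 0 the nth coefficient of af pairs f with ā z^n, whose frequencies are all
negative. -/
lemma mulL_mem_hardy {a : L ∞} (ha : a ∈ hardy ∞) {f : L 2} (hf : f ∈ hardy 2) :
    mulL a f ∈ hardy 2 := by
  intro n hn
  rw [← inner_fourier, ← inner_mulL_star]
  rw [← inner_conj_symm]
  refine (map_eq_zero _).2 ((Submodule.mem_orthogonal _ _).1 ?_ f hf)
  rw [mem_hardy_orthogonal]
  intro k hk
  have : (mulL (star a) (contL 2 (fourier n)) : 𝕋 → ℂ) =ᵐ[m]
      fun x => fourier n x * starRingEnd ℂ (a x) := by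
    filter_upwards [coeFn_mulL (star a) (contL 2 (fourier n)), coeFn_contL 2 (fourier n),
      Lp.coeFn_star a] with x h1 h2 h3
    rw [h1, h2, h3, mul_comm]
    rfl
  rw [fourierCoeff_congr_ae this, fourierCoeff_fourier_mul, fourierCoeff_conj,
    ha _ (by omega), map_zero]

lemma continuousLinearMap_eq_zero_of_fourier {E : Type*} [NormedAddCommGroup E] [NormedSpace ℂ E]
    (T : L 2 →L[ℂ] E) (h : ∀ n : ℤ, T (contL 2 (fourier n)) = 0) : T = 0 := by
  refine ContinuousLinearMap.ext_on (s := Set.range (fourierLp (T := 2 * Real.pi) 2)) ?_ ?_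
  · rw [Submodule.dense_iff_topologicalClosure_eq_top]
    exact span_fourierLp_closure_eq_top (by simp)
  · rintro _ ⟨n, rfl⟩
    exact h n

lemma fourierCoeff_coeFn_add {p : ℝ≥0∞} [hp : Fact (1 ≤ p)] (f g : L p) (n : ℤ) :
    fourierCoeff ((f + g : L p) : 𝕋 → ℂ) n =
      fourierCoeff (f : 𝕋 → ℂ) n + fourierCoeff (g : 𝕋 → ℂ) n := by
  rw [fourierCoeff_congr_ae (Lp.coeFn_add f g),
    fourierCoeff.add (integrable_of_L hp.out f) (integrable_of_L hp.out g)]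
  rfl

lemma fourierCoeff_coeFn_smul {p : ℝ≥0∞} [Fact (1 ≤ p)] (c : ℂ) (f : L p) (n : ℤ) :
    fourierCoeff ((c • f : L p) : 𝕋 → ℂ) n = c * fourierCoeff (f : 𝕋 → ℂ) n := by
  rw [fourierCoeff_congr_ae (Lp.coeFn_smul c f), fourierCoeff.const_smul, smul_eq_mul]

lemma fourierCoeff_coeFn_sub {p : ℝ≥0∞} [hp : Fact (1 ≤ p)] (f g : L p) (n : ℤ) :
    fourierCoeff ((f - g : L p) : 𝕋 → ℂ) n =
      fourierCoeff (f : 𝕋 → ℂ) n - fourierCoeff (g : 𝕋 → ℂ) n := by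
  have h : f - g = f + (-1 : ℂ) • g := by simp [sub_eq_add_neg]
  rw [h, fourierCoeff_coeFn_add, fourierCoeff_coeFn_smul]
  ring

/-- The `n`-th Fourier coefficient, as a linear functional. -/
def coeffₗ (p : ℝ≥0∞) [Fact (1 ≤ p)] (n : ℤ) : L p →ₗ[ℂ] ℂ where
  toFun f := fourierCoeff (f : 𝕋 → ℂ) n
  map_add' f g := fourierCoeff_coeFn_add f g n
  map_smul' c f := fourierCoeff_coeFn_smul c f n

/-- Trigonometric polynomials. -/
def trigPoly (s : Finset ℤ) (a : ℤ → ℂ) : C(𝕋, ℂ) := ∑ j ∈ s, a j • fourier j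

lemma fourierCoeff_trigPoly (p : ℝ≥0∞) [Fact (1 ≤ p)] (s : Finset ℤ) (a : ℤ → ℂ) (n : ℤ) :
    fourierCoeff (contL p (trigPoly s a) : 𝕋 → ℂ) n = if n ∈ s then a n else 0 := by
  change coeffₗ p n (contL p (trigPoly s a)) = _
  rw [trigPoly, map_sum, map_sum, ← Finset.sum_ite_eq s n a]
  refine Finset.sum_congr rfl fun j _ => ?_
  rw [map_smul, map_smul]
  change a j • fourierCoeff _ n = _
  rw [fourierCoeff_contL_fourier]
  simp

lemma projH_eq_trigPoly {g : L 2} {N : ℤ} (h : ∀ n, N < n → fourierCoeff (g : 𝕋 → ℂ) n = 0) :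
    projH g = contL 2 (trigPoly (Finset.Icc 0 N) (fourierCoeff (g : 𝕋 → ℂ))) := by
  refine projH_eq (fun n hn => ?_) (mem_hardy_orthogonal.2 fun n hn => ?_)
  · rw [fourierCoeff_trigPoly, if_neg (by simp; omega)]
  · rw [fourierCoeff_coeFn_sub, fourierCoeff_trigPoly]
    split_ifs with hs
    · simp
    · rw [h n (by simp at hs; omega), sub_zero]

lemma projHc_eq_trigPoly {g : L 2} {N : ℤ} (h : ∀ n, n < N → fourierCoeff (g : 𝕋 → ℂ) n = 0) :
    projHc g = contL 2 (trigPoly (Finset.Ico N 0) (fourierCoeff (g : 𝕋 → ℂ))) := by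
  rw [projHc_apply, sub_eq_iff_eq_add', ← sub_eq_iff_eq_add]
  symm
  refine projH_eq (fun n hn => ?_) (mem_hardy_orthogonal.2 fun n hn => ?_)
  · rw [fourierCoeff_coeFn_sub, fourierCoeff_trigPoly]
    split_ifs with hs
    · simp
    · rw [h n (by simp at hs; omega), sub_zero]
  · rw [sub_sub_cancel, fourierCoeff_trigPoly, if_neg (by simp; omega)]

/-! ### Hankel operators and compactness for continuous symbols -/

/-- The Hankel operator with bounded symbol `a`, extended by zero to `L²`. -/
def hankel : L ∞ →L[ℂ] L 2 →L[ℂ] L 2 :=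
  (ContinuousLinearMap.compL ℂ (L 2) (L 2) (L 2) projHc) ∘L
    ((ContinuousLinearMap.compL ℂ (L 2) (L 2) (L 2)).flip projH) ∘L mulL

lemma hankel_apply (a : L ∞) (f : L 2) : hankel a f = projHc (mulL a (projH f)) := rfl

/-- Multiplying H² by z^k leaves only the negative frequencies k ≤ j < 0, so the operator has finite
rank. -/
lemma isCompactOperator_hankel_fourier (k : ℤ) :
    IsCompactOperator (hankel (contL ∞ (fourier k))) := by
  have : hankel (contL ∞ (fourier k)) = ∑ j ∈ Finset.Ico k 0,
      (ContinuousLinearMap.toSpanSingleton ℂ (contL 2 (fourier j))) ∘L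
        (innerSL ℂ (contL 2 (fourier j)) ∘L mulL (contL ∞ (fourier k)) ∘L projH) := by
    ext1 f
    rw [hankel_apply, projHc_eq_trigPoly (N := k), trigPoly, map_sum, sum_apply]
    · refine Finset.sum_congr rfl fun j _ => ?_
      rw [map_smul, ← inner_fourier]
      rfl
    · intro n hn
      rw [fourierCoeff_mulL_fourier]
      exact (Submodule.starProjection_apply_mem (hardy 2) f) _ (by omega)
  rw [this]
  refine Submodule.sum_mem (compactOperator (RingHom.id ℂ) (L 2) (L 2)) fun j _ => ?_
  have h := isCompactOperator_of_locallyCompactSpace_dom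
    (innerSL ℂ (contL 2 (fourier j)) ∘L mulL (contL ∞ (fourier k)) ∘L projH)
  exact h.clm_comp (ContinuousLinearMap.toSpanSingleton ℂ (contL 2 (fourier j)))

/-- Trigonometric polynomials are uniformly dense, and compact operators are closed in norm. -/
lemma isCompactOperator_hankel_continuous (c : C(𝕋, ℂ)) :
    IsCompactOperator (hankel (contL ∞ c)) := by
  let S : Submodule ℂ C(𝕋, ℂ) :=
    (compactOperator (RingHom.id ℂ) (L 2) (L 2)).comap
      (hankel ∘L contL ∞ : C(𝕋, ℂ) →L[ℂ] _).toLinearMap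
  have hS : IsClosed (S : Set C(𝕋, ℂ)) :=
    isClosed_setOfPred_isCompactOperator.preimage (hankel ∘L contL ∞ : C(𝕋, ℂ) →L[ℂ] _).continuous
  have h : (⊤ : Submodule ℂ C(𝕋, ℂ)) ≤ S := by
    rw [← span_fourier_closure_eq_top (T := 2 * Real.pi)]
    refine Submodule.topologicalClosure_minimal _ (Submodule.span_le.2 ?_) hS
    rintro _ ⟨k, rfl⟩
    exact isCompactOperator_hankel_fourier k
  exact h (Submodule.mem_top (x := c))

lemma hankel_eq_zero {a : L ∞} (ha : a ∈ hardy ∞) : hankel a = 0 := by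
  ext1 f
  exact projHc_eq_zero (mulL_mem_hardy ha (Submodule.starProjection_apply_mem _ f))

/-! ### The projection onto the model space -/

/-- `T ∈ H^∞` is the boundary function of `Θ`, and is unimodular. -/
structure IsInnerBoundary (Θ : ℂ → ℂ) (T : L ∞) : Prop where
  mem : T ∈ hardy ∞
  norm_eq : ∀ᵐ x ∂m, ‖T x‖ = 1
  eq_boundary : boundary Θ =ᵐ[m] T

namespace IsInnerBoundary

variable {Θ : ℂ → ℂ} {T : L ∞}

lemma mulL_star_mulL (h : IsInnerBoundary Θ T) (f : L 2) : mulL (star T) (mulL T f) = f := by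
  refine Lp.ext ?_
  filter_upwards [coeFn_mulL (star T) (mulL T f), coeFn_mulL T f, Lp.coeFn_star T, h.norm_eq]
    with x h1 h2 h3 h4
  rw [h1, h2, h3, ← mul_assoc, Pi.star_apply, RCLike.star_def, RCLike.conj_mul, h4]
  simp

lemma mulL_mulL_star (h : IsInnerBoundary Θ T) (f : L 2) : mulL T (mulL (star T) f) = f := by
  rw [mulL_comm, h.mulL_star_mulL]

lemma mem_shiftInvariant (h : IsInnerBoundary Θ T) {f : L 2} :
    f ∈ shiftInvariant Θ ↔ ∃ g ∈ hardy 2, f = mulL T g := by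
  refine exists_congr fun g => and_congr_right fun _ => ⟨fun hf => Lp.ext ?_, ?_⟩
  · filter_upwards [hf, coeFn_mulL T g, h.eq_boundary] with x h1 h2 h3
    rw [h1, h2, h3]
  · rintro rfl
    filter_upwards [coeFn_mulL T g, h.eq_boundary] with x h2 h3
    rw [h2, h3]

/-- Multiplication by T is an isometry, so TPT̄ is the projection onto ΘH² ⊆ H²; subtracting it from
P leaves K_Θ. -/
lemma starProjection_modelSpace (h : IsInnerBoundary Θ T) (f : L 2) :
    (modelSpace Θ).starProjection f = projH f - mulL T (projH (mulL (star T) f)) := by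
  have hP (g : L 2) : projH g ∈ hardy 2 := Submodule.starProjection_apply_mem _ g
  refine Submodule.eq_starProjection_of_mem_orthogonal ⟨sub_mem (hP _) (mulL_mem_hardy h.mem (hP _)),
    (Submodule.mem_orthogonal _ _).2 ?_⟩ ?_
  · intro u hu
    obtain ⟨g, hg, rfl⟩ := h.mem_shiftInvariant.1 hu
    have hg' := mulL_mem_hardy h.mem hg
    rw [inner_sub_right, ← Submodule.inner_starProjection_left_eq_right,
      Submodule.starProjection_eq_self_iff.2 hg', ← inner_mulL_star, h.mulL_star_mulL,
      ← Submodule.inner_starProjection_left_eq_right, Submodule.starProjection_eq_self_iff.2 hg,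
      ← inner_mulL_star, sub_eq_zero]
    congr 1
    refine Lp.ext ?_
    filter_upwards [coeFn_mulL (star (star T)) g, coeFn_mulL T g] with x h1 h2
    rw [h1, h2, star_star]
  · rw [← sub_add]
    refine add_mem ?_ ?_
    · exact Submodule.orthogonal_le inf_le_left (projHc_mem f)
    · exact Submodule.orthogonal_le inf_le_right
        (Submodule.le_orthogonal_orthogonal _ (h.mem_shiftInvariant.2 ⟨_, hP _, rfl⟩))

lemma starProjection_mulL (h : IsInnerBoundary Θ T) {f : L 2} (hf : f ∈ hardy 2) :
    (modelSpace Θ).starProjection (mulL T f) = 0 := by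
  rw [h.starProjection_modelSpace, h.mulL_star_mulL, Submodule.starProjection_eq_self_iff.2 hf,
    Submodule.starProjection_eq_self_iff.2 (mulL_mem_hardy h.mem hf), sub_self]

/-- Both sides are the projection onto the complement of ΘH² in L². This is the bridge between
truncated Toeplitz and Hankel operators. -/
lemma mulL_projHc_mulL_star (h : IsInnerBoundary Θ T) (f : L 2) :
    mulL T (projHc (mulL (star T) f)) = (modelSpace Θ).starProjection f + projHc f := by
  rw [h.starProjection_modelSpace, projHc_apply, projHc_apply, map_sub, h.mulL_mulL_star]
  abel

/-- Both P z^n and P(T̄ z^n) have frequencies in [0, n] only, so the projection is p - Tq with p, q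
polynomials. Hence the domain of `tto` contains a set with dense span in K_Θ. -/
lemma memLp_starProjection_fourier (h : IsInnerBoundary Θ T) (n : ℤ) :
    MemLp ((modelSpace Θ).starProjection (contL 2 (fourier n)) : 𝕋 → ℂ) ∞ m := by
  have h1 : projH (contL 2 (fourier n)) =
      contL 2 (trigPoly (Finset.Icc 0 n) (fourierCoeff (contL 2 (fourier n) : 𝕋 → ℂ))) :=
    projH_eq_trigPoly fun k hk => by rw [fourierCoeff_contL_fourier, if_neg hk.ne']
  have h2 : projH (mulL (star T) (contL 2 (fourier n))) = contL 2 (trigPoly (Finset.Icc 0 n)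
      (fourierCoeff (mulL (star T) (contL 2 (fourier n)) : 𝕋 → ℂ))) := by
    refine projH_eq_trigPoly fun k hk => ?_
    have : (mulL (star T) (contL 2 (fourier n)) : 𝕋 → ℂ) =ᵐ[m]
        fun x => fourier n x * starRingEnd ℂ (T x) := by
      filter_upwards [coeFn_mulL (star T) (contL 2 (fourier n)), coeFn_contL 2 (fourier n),
        Lp.coeFn_star T] with x h1 h2 h3
      rw [h1, h2, h3, mul_comm]
      rfl
    rw [fourierCoeff_congr_ae this, fourierCoeff_fourier_mul, fourierCoeff_conj,
      h.mem _ (by omega), map_zero]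
  rw [h.starProjection_modelSpace, h1, h2]
  generalize trigPoly _ _ = p
  generalize trigPoly _ _ = q
  have hp : MemLp p ∞ m := p.memLp m ℂ
  have hq : MemLp q ∞ m := q.memLp m ℂ
  refine (memLp_congr_ae ?_).2 (hp.sub (hq.mul (r := ∞) (Lp.memLp T)))
  filter_upwards [Lp.coeFn_sub (contL 2 p) (mulL T (contL 2 q)), coeFn_mulL T (contL 2 q),
    coeFn_contL 2 p, coeFn_contL 2 q] with x h1 h2 h3 h4
  rw [h1, Pi.sub_apply, h2, h3, h4]
  rfl

end IsInnerBoundary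

/-! ### Truncated Toeplitz operators versus Hankel operators -/

lemma tto_apply_eq {Θ : ℂ → ℂ} {φ : L 2} {Φ : L ∞}
    (hΦ : (φ : 𝕋 → ℂ) =ᵐ[m] Φ) (f : (tto Θ φ).domain) :
    tto Θ φ f = (modelSpace Θ).orthogonalProjectionOnto (mulL Φ ((f : modelSpace Θ) : L 2)) := by
  change (modelSpace Θ).orthogonalProjectionOnto ((memLp_symbol_mul φ f).toLp _) = _
  congr 1
  refine Lp.ext ?_
  filter_upwards [(memLp_symbol_mul φ f).coeFn_toLp, coeFn_mulL Φ ((f : modelSpace Θ) : L 2), hΦ]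
    with x h1 h2 h3
  rw [h1, h2, h3]

/-- The truncated Toeplitz operator with bounded symbol, as a bounded operator. -/
def boundedTTO (Θ : ℂ → ℂ) (Φ : L ∞) : modelSpace Θ →L[ℂ] modelSpace Θ :=
  (modelSpace Θ).orthogonalProjectionOnto ∘L mulL Φ ∘L (modelSpace Θ).subtypeL

/-- The domain is dense in K_Θ, so a bounded extension is unique and must be `boundedTTO`. -/
theorem extendsCompactly_tto_iff {Θ : ℂ → ℂ} {T : L ∞} (hT : IsInnerBoundary Θ T) {φ : L 2}
    {Φ : L ∞} (hΦ : (φ : 𝕋 → ℂ) =ᵐ[m] Φ) :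
    ExtendsCompactly (tto Θ φ) ↔ IsCompactOperator (boundedTTO Θ Φ) := by
  constructor
  · rintro ⟨B, hB, hBf⟩
    have h : (B - boundedTTO Θ Φ) ∘L (modelSpace Θ).orthogonalProjectionOnto = 0 := by
      refine continuousLinearMap_eq_zero_of_fourier _ fun n => ?_
      have := hBf ⟨(modelSpace Θ).orthogonalProjectionOnto (contL 2 (fourier n)),
        hT.memLp_starProjection_fourier n⟩
      rw [tto_apply_eq hΦ] at this
      exact sub_eq_zero.2 this
    have h' : B = boundedTTO Θ Φ := by
      ext1 f
      have := congrArg (fun A : L 2 →L[ℂ] modelSpace Θ => A (f : L 2)) h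
      simpa [sub_eq_zero] using this
    rwa [← h']
  · intro h
    exact ⟨_, h, fun f => (tto_apply_eq hΦ f).symm⟩

/-- The product of essentially bounded functions. -/
def mulInf (a b : L ∞) : L ∞ := (ContinuousLinearMap.mul ℂ ℂ).holder ∞ a b

lemma coeFn_mulInf (a b : L ∞) : (mulInf a b : 𝕋 → ℂ) =ᵐ[m] fun x => a x * b x :=
  (ContinuousLinearMap.mul ℂ ℂ).coeFn_holder a b

lemma mulL_mulInf (a b : L ∞) (f : L 2) : mulL (mulInf a b) f = mulL a (mulL b f) := by
  refine Lp.ext ?_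
  filter_upwards [coeFn_mulL (mulInf a b) f, coeFn_mulInf a b, coeFn_mulL a (mulL b f),
    coeFn_mulL b f] with x h1 h2 h3 h4
  rw [h1, h2, h3, h4, mul_assoc]

theorem isCompactOperator_boundedTTO {Θ : ℂ → ℂ} {T : L ∞} (hT : IsInnerBoundary Θ T)
    (c : C(𝕋, ℂ)) {h : L ∞} (hh : h ∈ hardy ∞) :
    IsCompactOperator (boundedTTO Θ (mulInf T (contL ∞ c + h))) := by
  have : boundedTTO Θ (mulInf T (contL ∞ c + h)) = ((modelSpace Θ).orthogonalProjectionOnto ∘L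
      mulL T) ∘L hankel (contL ∞ c + h) ∘L (modelSpace Θ).subtypeL := by
    ext1 f
    refine Subtype.ext ?_
    have hf : projH (f : L 2) = f := Submodule.starProjection_eq_self_iff.2 f.2.1
    change (modelSpace Θ).starProjection (mulL _ (f : L 2)) =
      (modelSpace Θ).starProjection (mulL T (hankel _ (f : L 2)))
    -- The H² part of (c + h)f, multiplied by T, lies in ΘH² and is killed by P_Θ; only the Hankel
    -- part survives.
    rw [mulL_mulInf, hankel_apply, hf, projHc_apply, map_sub, map_sub,
      hT.starProjection_mulL (Submodule.starProjection_apply_mem _ _), sub_zero]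
  have hH : IsCompactOperator (hankel (contL ∞ c + h)) := by
    rw [map_add, hankel_eq_zero hh, add_zero]
    exact isCompactOperator_hankel_continuous c
  rw [this]
  exact (hH.comp_clm (modelSpace Θ).subtypeL).clm_comp
    ((modelSpace Θ).orthogonalProjectionOnto ∘L mulL T)

theorem isCompactOperator_hankel_star_mul {Θ : ℂ → ℂ} {T : L ∞} (hT : IsInnerBoundary Θ T)
    (c : C(𝕋, ℂ)) {h : L ∞} (hh : h ∈ hardy ∞)
    (hc : IsCompactOperator (boundedTTO Θ (contL ∞ c + h))) :
    IsCompactOperator (hankel (mulInf (star T) (contL ∞ c + h))) := by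
  have hH : IsCompactOperator (hankel (contL ∞ c + h)) := by
    rw [map_add, hankel_eq_zero hh, add_zero]
    exact isCompactOperator_hankel_continuous c
  set Φ := contL ∞ c + h
  have key : hankel (mulInf (star T) Φ) =
      mulL (star T) ∘L ((modelSpace Θ).subtypeL ∘L boundedTTO Θ Φ ∘L
        (modelSpace Θ).orthogonalProjectionOnto +
        hankel Φ ∘L (modelSpace Θ).starProjection) +
      hankel Φ ∘L mulL (star T) := by
    ext1 f
    have hK := (modelSpace Θ).starProjection_apply_mem f
    -- Splitting along H² = K_Θ ⊕ ΘH². On the second summand the factor T cancels T̄ and leaves the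
    -- Hankel operator of Φ at T̄f.
    have h1 : projH f = (modelSpace Θ).starProjection f + mulL T (projH (mulL (star T) f)) := by
      rw [hT.starProjection_modelSpace, sub_add_cancel]
    have h2 : projH ((modelSpace Θ).starProjection f) = (modelSpace Θ).starProjection f :=
      Submodule.starProjection_eq_self_iff.2 hK.1
    change hankel _ f = mulL (star T) ((modelSpace Θ).starProjection
      (mulL Φ ((modelSpace Θ).starProjection f)) + hankel Φ ((modelSpace Θ).starProjection f)) +
      hankel Φ (mulL (star T) f)
    rw [hankel_apply, h1, hankel_apply, h2, ← hT.mulL_projHc_mulL_star, hT.mulL_star_mulL,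
      map_add, map_add, mulL_mulInf, mulL_mulInf, mulL_comm Φ T, hT.mulL_star_mulL]
    rfl
  rw [key]
  have h1 := (hc.comp_clm (modelSpace Θ).orthogonalProjectionOnto).clm_comp (modelSpace Θ).subtypeL
  have h2 := hH.comp_clm (modelSpace Θ).starProjection
  exact ((h1.add h2).clm_comp (mulL (star T))).add (hH.comp_clm (mulL (star T)))

/-! ### Boundary values of inner functions -/

lemma coe_toCircle (x : ℝ) : (AddCircle.toCircle (x : 𝕋) : ℂ) = circleMap 0 1 x := by
  rw [AddCircle.toCircle_apply_mk, div_self Real.two_pi_pos.ne', one_mul, Circle.coe_exp]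
  simp [circleMap]

/-- Cauchy's theorem for z^k F with k = -n - 1; the differential dz supplies the remaining factor z.
-/
lemma fourierCoeff_of_diffContOnCl {F : ℂ → ℂ} (hF : DiffContOnCl ℂ F (Metric.ball 0 1)) {n : ℤ}
    (hn : n < 0) : fourierCoeff (fun x : 𝕋 => F (AddCircle.toCircle x)) n = 0 := by
  obtain ⟨k, hk⟩ : ∃ k : ℕ, -n = (k + 1 : ℕ) := ⟨(-n - 1).toNat, by omega⟩
  have h1 : DiffContOnCl ℂ (fun z => z ^ k • F z) (Metric.ball 0 1) :=
    DiffContOnCl.smul (Differentiable.diffContOnCl (by fun_prop)) hF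
  have h2 := h1.circleIntegral_eq_zero zero_le_one
  rw [fourierCoeff_eq_intervalIntegral _ _ 0, zero_add]
  rw [circleIntegral] at h2
  have h3 : ∀ x : ℝ, deriv (circleMap 0 1) x • (circleMap 0 1 x ^ k • F (circleMap 0 1 x)) =
      Complex.I * (fourier (-n) (x : 𝕋) • F (AddCircle.toCircle (x : 𝕋))) := by
    intro x
    rw [hk, fourier_apply, AddCircle.toCircle_zsmul, zpow_natCast, Circle.coe_pow, coe_toCircle,
      deriv_circleMap]
    simp only [smul_eq_mul]
    ring
  simp_rw [h3] at h2
  rw [intervalIntegral.integral_const_mul] at h2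
  rw [(mul_eq_zero.1 h2).resolve_left Complex.I_ne_zero, smul_zero]

/-- The dilates Θ(r_j z) are analytic past the closed disc, so their negative coefficients vanish;
dominated convergence carries this to the radial limit. -/
lemma exists_isInnerBoundary {Θ : ℂ → ℂ} (hΘ : IsInner Θ) : ∃ T : L ∞, IsInnerBoundary Θ T := by
  obtain ⟨C, hC⟩ := hΘ.bounded
  let r : ℕ → ℝ := fun j => 1 - 1 / ((j : ℝ) + 2)
  have hr0 (j) : 0 ≤ r j := by
    have : 1 / ((j : ℝ) + 2) ≤ 1 := by
      rw [div_le_one (by positivity)]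
      linarith [(Nat.cast_nonneg j : (0 : ℝ) ≤ j)]
    simpa [r] using this
  have hr1 (j) : r j < 1 := by
    have : 0 < 1 / ((j : ℝ) + 2) := by positivity
    simp only [r]
    linarith
  have hr : Tendsto r atTop (𝓝[<] 1) := by
    refine tendsto_nhdsWithin_iff.2 ⟨?_, Eventually.of_forall hr1⟩
    have h := (tendsto_const_div_atTop_nhds_zero_nat (1 : ℝ)).comp (tendsto_add_atTop_nat 2)
    have h' := h.const_sub 1
    simpa [r, Function.comp_def] using h'
  have hmem (j : ℕ) {z : ℂ} (hz : ‖z‖ ≤ 1) : (r j : ℂ) * z ∈ Metric.ball (0 : ℂ) 1 := by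
    rw [mem_ball_zero_iff, norm_mul, Complex.norm_real, Real.norm_of_nonneg (hr0 j)]
    calc r j * ‖z‖ ≤ r j * 1 := by gcongr; exact hr0 j
      _ < 1 := by simpa using hr1 j
  have hF (j : ℕ) : DiffContOnCl ℂ (fun z => Θ (r j * z)) (Metric.ball 0 1) := by
    refine DifferentiableOn.diffContOnCl ?_
    rw [closure_ball _ one_ne_zero]
    refine hΘ.analytic.comp (by fun_prop) fun z hz => hmem j (by simpa using hz)
  have hcont (j : ℕ) : Continuous fun x : 𝕋 => Θ (r j * (AddCircle.toCircle x : ℂ)) := by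
    refine hΘ.analytic.continuousOn.comp_continuous ?_ fun x => hmem j (Circle.norm_coe _).le
    fun_prop
  have hlim : ∀ᵐ x ∂m, ‖boundary Θ x‖ = 1 ∧
      Tendsto (fun j => Θ (r j * (AddCircle.toCircle x : ℂ))) atTop (𝓝 (boundary Θ x)) := by
    filter_upwards [hΘ.radial] with x ⟨w, hw, hx⟩
    have : boundary Θ x = w := hx.limUnder_eq
    rw [this]
    exact ⟨hw, hx.comp hr⟩
  have hmeas : AEStronglyMeasurable (boundary Θ) m :=
    aestronglyMeasurable_of_tendsto_ae atTop (fun j => (hcont j).aestronglyMeasurable)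
      (hlim.mono fun x h => h.2)
  have hLp : MemLp (boundary Θ) ∞ m := memLp_top_of_bound hmeas 1 (hlim.mono fun x h => h.1.le)
  refine ⟨hLp.toLp, fun n hn => ?_, ?_, hLp.coeFn_toLp.symm⟩
  · rw [fourierCoeff_congr_ae hLp.coeFn_toLp]
    refine tendsto_nhds_unique (tendsto_integral_of_dominated_convergence
      (F := fun j x => fourier (-n) x • Θ (r j * (AddCircle.toCircle x : ℂ))) (fun _ => C)
      (fun j => ((map_continuous (fourier (-n))).smul (hcont j)).aestronglyMeasurable)
      (integrable_const C) (fun j => Eventually.of_forall fun x => ?_)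
      (hlim.mono fun x h => h.2.const_smul _)) ?_
    · rw [norm_smul, fourier_apply, Circle.norm_coe, one_mul]
      exact hC _ (hmem j (Circle.norm_coe _).le)
    · refine tendsto_const_nhds.congr fun j => ?_
      exact (fourierCoeff_of_diffContOnCl (hF j) hn).symm
  · filter_upwards [hLp.coeFn_toLp, hlim] with x h1 h2
    rw [h1, h2.1]

/-! ### Balanced factorization of polynomials -/

/-- On the closed disc Re(1 - bz) ≥ 0, where the principal square root is continuous, even at 0; on
the open disc the real part is positive. -/
lemma diffContOnCl_sqrt {b : ℂ} (hb : ‖b‖ ≤ 1) :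
    DiffContOnCl ℂ (fun z => (1 - b * z) ^ (2⁻¹ : ℂ)) (Metric.ball 0 1) := by
  have hre (z : ℂ) : 1 - ‖z‖ ≤ (1 - b * z).re := by
    have h1 : (b * z).re ≤ ‖z‖ := by
      refine (Complex.re_le_norm _).trans ?_
      rw [norm_mul]
      exact mul_le_of_le_one_left (norm_nonneg _) hb
    rw [Complex.sub_re, Complex.one_re]
    linarith
  refine ⟨fun z hz => ?_, fun z hz => ?_⟩
  · have hz' : ‖z‖ < 1 := by simpa using hz
    refine (DifferentiableAt.cpow_const (by fun_prop) (Or.inl ?_)).differentiableWithinAt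
    linarith [hre z]
  · rw [closure_ball _ one_ne_zero] at hz
    have hz' : ‖z‖ ≤ 1 := by simpa using hz
    have h := Complex.continuousAt_cpow_const_of_re_pos (z := 1 - b * z) (w := 2⁻¹)
      (Or.inl (by linarith [hre z])) (by norm_num)
    exact (ContinuousAt.comp (f := fun z => 1 - b * z) h (by fun_prop)).continuousWithinAt

/-- `f` factors on the unit circle as a product of two disc algebra functions of equal modulus. -/
def HasBalancedFactorization (f : ℂ → ℂ) : Prop :=
  ∃ F G : ℂ → ℂ, DiffContOnCl ℂ F (Metric.ball 0 1) ∧ DiffContOnCl ℂ G (Metric.ball 0 1) ∧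
    ∀ z, ‖z‖ = 1 → f z = F z * G z ∧ ‖F z‖ = ‖G z‖

lemma HasBalancedFactorization.mul {f g : ℂ → ℂ} (hf : HasBalancedFactorization f)
    (hg : HasBalancedFactorization g) : HasBalancedFactorization fun z => f z * g z := by
  obtain ⟨F₁, G₁, hF₁, hG₁, h₁⟩ := hf
  obtain ⟨F₂, G₂, hF₂, hG₂, h₂⟩ := hg
  refine ⟨fun z => F₁ z • F₂ z, fun z => G₁ z • G₂ z, hF₁.smul hF₂, hG₁.smul hG₂, fun z hz => ?_⟩
  obtain ⟨a₁, b₁⟩ := h₁ z hz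
  obtain ⟨a₂, b₂⟩ := h₂ z hz
  refine ⟨?_, by rw [norm_smul, norm_smul, b₁, b₂]⟩
  simp only [a₁, a₂, smul_eq_mul]
  ring

lemma hasBalancedFactorization_const (c : ℂ) : HasBalancedFactorization fun _ => c := by
  obtain ⟨w, hw⟩ := IsAlgClosed.exists_pow_nat_eq c two_pos
  exact ⟨fun _ => w, fun _ => w, diffContOnCl_const, diffContOnCl_const,
    fun z _ => ⟨by rw [← hw, sq], rfl⟩⟩

lemma cpow_half_mul_self (w : ℂ) : w ^ (2⁻¹ : ℂ) * w ^ (2⁻¹ : ℂ) = w := by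
  rw [← sq]
  exact_mod_cast Complex.cpow_nat_inv_pow w two_ne_zero

/-- If |a| ≥ 1, then 1 - z/a has a square root in the disc algebra. If |a| < 1, then |z - a| = |1 -
āz| on the circle, so G = (1 - āz)^{1/2} and F = (z - a)/G have equal modulus there. -/
lemma hasBalancedFactorization_sub (a : ℂ) : HasBalancedFactorization fun z => z - a := by
  rcases le_or_gt 1 ‖a‖ with ha | ha
  · have ha0 : a ≠ 0 := by
      rintro rfl
      norm_num at ha
    have hs : HasBalancedFactorization fun z => 1 - a⁻¹ * z := by
      have := diffContOnCl_sqrt (b := a⁻¹) (by rw [norm_inv]; exact inv_le_one_of_one_le₀ ha)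
      exact ⟨_, _, this, this, fun z _ => ⟨(cpow_half_mul_self _).symm, rfl⟩⟩
    convert (hasBalancedFactorization_const (-a)).mul hs using 2 with z
    field_simp
    ring
  · have hs := diffContOnCl_sqrt (b := starRingEnd ℂ a) (by simpa using ha.le)
    have h0 : ∀ z : ℂ, ‖z‖ ≤ 1 → 1 - starRingEnd ℂ a * z ≠ 0 := by
      intro z hz h
      have : ‖starRingEnd ℂ a * z‖ < 1 := by
        rw [norm_mul, RCLike.norm_conj]
        nlinarith [norm_nonneg a, norm_nonneg z]
      rw [← sub_eq_zero.1 h] at this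
      simp at this
    have hs0 : ∀ z : ℂ, ‖z‖ ≤ 1 → (1 - starRingEnd ℂ a * z) ^ (2⁻¹ : ℂ) ≠ 0 := by
      intro z hz h
      apply h0 z hz
      rw [← cpow_half_mul_self (1 - _), h, zero_mul]
    refine ⟨fun z => (z - a) • ((1 - starRingEnd ℂ a * z) ^ (2⁻¹ : ℂ))⁻¹, _,
      DiffContOnCl.smul (Differentiable.diffContOnCl (by fun_prop)) (hs.inv fun z hz => hs0 z ?_),
      hs, fun z hz => ⟨?_, ?_⟩⟩
    · simpa [closure_ball] using hz
    · simp only [smul_eq_mul]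
      rw [inv_mul_cancel_right₀ (hs0 z hz.le)]
    · have h1 : ‖z - a‖ = ‖1 - starRingEnd ℂ a * z‖ := by
        have : starRingEnd ℂ z * z = 1 := by rw [RCLike.conj_mul, hz]; simp
        calc ‖z - a‖ = ‖starRingEnd ℂ (z - a) * z‖ := by rw [norm_mul, RCLike.norm_conj, hz, mul_one]
          _ = _ := by rw [map_sub, sub_mul, this]
      have h2 := congrArg norm (cpow_half_mul_self (1 - starRingEnd ℂ a * z))
      rw [norm_mul] at h2
      rw [norm_smul, norm_inv, h1, ← h2, mul_inv_cancel_right₀ (norm_ne_zero_iff.2 (hs0 z hz.le))]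

theorem hasBalancedFactorization_polynomial (p : Polynomial ℂ) :
    HasBalancedFactorization fun z => p.eval z := by
  rw [(IsAlgClosed.splits p).eq_prod_roots]
  simp only [Polynomial.eval_mul, Polynomial.eval_C]
  refine (hasBalancedFactorization_const _).mul ?_
  induction p.roots using Multiset.induction_on with
  | empty => simpa using hasBalancedFactorization_const 1
  | cons a s ih =>
    simp only [Multiset.map_cons, Multiset.prod_cons, Polynomial.eval_mul, Polynomial.eval_sub,
      Polynomial.eval_X, Polynomial.eval_C]
    exact (hasBalancedFactorization_sub a).mul ih

/-! ### Duality and Nehari's theorem -/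

lemma norm_sq_contL_two (c : C(𝕋, ℂ)) : ‖contL 2 c‖ ^ 2 = ∫ x, ‖c x‖ ^ 2 ∂m := by
  have h : (inner ℂ (contL 2 c) (contL 2 c) : ℂ) = ((∫ x, ‖c x‖ ^ 2 ∂m : ℝ) : ℂ) := by
    rw [L2.inner_def, ← integral_complex_ofReal]
    refine integral_congr_ae ?_
    filter_upwards [coeFn_contL 2 c] with x hx
    rw [hx, inner_self_eq_norm_sq_to_K]
    simp
  rw [inner_self_eq_norm_sq_to_K] at h
  exact Complex.ofReal_injective ((Complex.ofReal_pow _ _).trans h)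

lemma norm_contL_one (c : C(𝕋, ℂ)) : ‖contL 1 c‖ = ∫ x, ‖c x‖ ∂m := by
  rw [L1.norm_eq_integral_norm]
  refine integral_congr_ae ?_
  filter_upwards [coeFn_contL 1 c] with x hx
  rw [hx]

lemma norm_le_of_ae_bound_top {g : L ∞} {C : ℝ} (hC : 0 ≤ C) (h : ∀ᵐ x ∂m, ‖g x‖ ≤ C) :
    ‖g‖ ≤ C := by
  simpa [measureUnivNNReal] using Lp.norm_le_of_ae_bound hC h

/-- Bounded functionals on `L¹` are given by essentially bounded functions. -/
theorem exists_integral_eq_of_clm_L_one (Λ : L 1 →L[ℂ] ℂ) :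
    ∃ g : L ∞, ‖g‖ ≤ ‖Λ‖ ∧ ∀ c : C(𝕋, ℂ), Λ (contL 1 c) = ∫ x, g x * c x ∂m := by
  -- The inclusion of L² in L¹, as Hölder multiplication by 1. Riesz representation on L² then gives
  -- a density, whose boundedness is to be shown.
  let J : L 2 →L[ℂ] L 1 := (ContinuousLinearMap.mul ℂ ℂ).holderL m 2 2 1 (contL 2 1)
  have hJ (f : L 2) : (J f : 𝕋 → ℂ) =ᵐ[m] f := by
    filter_upwards [(ContinuousLinearMap.mul ℂ ℂ).coeFn_holder (r := 1) (contL 2 1) f,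
      coeFn_contL 2 1] with x h1 h2
    refine h1.trans ?_
    rw [h2]
    simp
  let g₀ : L 2 := (InnerProductSpace.toDual ℂ (L 2)).symm (Λ ∘L J)
  have hg₀ (f : L 2) : Λ (J f) = ∫ x, starRingEnd ℂ (g₀ x) * f x ∂m := by
    have : inner ℂ g₀ f = Λ (J f) := InnerProductSpace.toDual_symm_apply
    rw [← this, L2.inner_def]
    simp only [RCLike.inner_apply']
  have hbound : ∀ᵐ x ∂m, ‖g₀ x‖ ≤ ‖Λ‖ := by
    refine ae_le_of_forall_setIntegral_le (integrable_of_L one_le_two g₀).norm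
      (integrable_const _) fun s hs _ => ?_
    -- Testing Λ on the phase of g₀ over s yields ∫_s |g₀| ≤ ‖Λ‖ m(s). The quotient is 0 where g₀
    -- vanishes.
    have hsgn : MemLp (s.indicator fun x => g₀ x / (‖g₀ x‖ : ℂ)) 2 m := by
      refine MemLp.indicator hs (MemLp.of_bound ?_ 1 (Eventually.of_forall fun x => ?_))
      · have h := (Lp.aestronglyMeasurable g₀).aemeasurable
        exact (h.div (Complex.measurable_ofReal.comp_aemeasurable h.norm)).aestronglyMeasurable
      · rw [norm_div, Complex.norm_real, norm_norm]
        exact div_self_le_one _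
    have h1 : Λ (J hsgn.toLp) = ((∫ x in s, ‖g₀ x‖ ∂m : ℝ) : ℂ) := by
      rw [hg₀, ← integral_complex_ofReal, ← integral_indicator hs]
      refine integral_congr_ae ?_
      filter_upwards [hsgn.coeFn_toLp] with x hx
      rw [hx]
      by_cases hxs : x ∈ s
      · simp only [Set.indicator_of_mem hxs]
        rcases eq_or_ne (g₀ x) 0 with h0 | h0
        · simp [h0]
        · have h0' : (‖g₀ x‖ : ℂ) ≠ 0 := by simpa using h0
          rw [← mul_div_assoc, RCLike.conj_mul, div_eq_iff h0', sq]
          rfl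
      · simp [hxs]
    have h2 : ‖J hsgn.toLp‖ ≤ m.real s := by
      rw [L1.norm_eq_integral_norm, ← integral_indicator_one hs]
      refine integral_mono_ae (L1.integrable_coeFn _).norm
        ((integrable_const 1).indicator hs) ?_
      filter_upwards [hJ hsgn.toLp, hsgn.coeFn_toLp] with x hx hx'
      simp only [hx, hx']
      by_cases hxs : x ∈ s
      · simp only [Set.indicator_of_mem hxs, Pi.one_apply]
        rw [norm_div, Complex.norm_real, norm_norm]
        exact div_self_le_one _
      · simp [hxs]
    have h3 : ∫ x in s, ‖g₀ x‖ ∂m = ‖Λ (J hsgn.toLp)‖ := by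
      rw [h1, Complex.norm_real, Real.norm_of_nonneg]
      exact integral_nonneg fun x => norm_nonneg _
    rw [h3, setIntegral_const, smul_eq_mul]
    refine (Λ.le_opNorm _).trans ?_
    rw [mul_comm (m.real s)]
    gcongr
  have hLp : MemLp (fun x => starRingEnd ℂ (g₀ x)) ∞ m :=
    memLp_top_of_bound (Complex.continuous_conj.comp_aestronglyMeasurable
      (Lp.aestronglyMeasurable g₀)) ‖Λ‖ (by simpa using hbound)
  refine ⟨hLp.toLp, norm_le_of_ae_bound_top (norm_nonneg _) ?_, fun c => ?_⟩
  · filter_upwards [hLp.coeFn_toLp, hbound] with x h1 h2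
    rwa [h1, RCLike.norm_conj]
  · have : contL 1 c = J (contL 2 c) := by
      refine Lp.ext ?_
      filter_upwards [coeFn_contL 1 c, coeFn_contL 2 c, hJ (contL 2 c)] with x h1 h2 h3
      rw [h1, h3, h2]
    rw [this, hg₀]
    refine integral_congr_ae ?_
    filter_upwards [hLp.coeFn_toLp, coeFn_contL 2 c] with x h1 h2
    rw [h1, h2]

/-- The functional `f ↦ ∫ ψ f` on `L¹`. -/
def pairing (ψ : L ∞) : L 1 →L[ℂ] ℂ := (ContinuousLinearMap.mul ℂ ℂ).lpPairing m ∞ 1 ψ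

lemma pairing_contL (ψ : L ∞) (c : C(𝕋, ℂ)) : pairing ψ (contL 1 c) = ∫ x, ψ x * c x ∂m := by
  refine ((ContinuousLinearMap.mul ℂ ℂ).lpPairing_eq_integral ψ _).trans (integral_congr_ae ?_)
  filter_upwards [coeFn_contL 1 c] with x h
  rw [h]
  rfl

/-- The function `z p(z)` on the circle. -/
def shiftedPoly : Polynomial ℂ →ₗ[ℂ] C(𝕋, ℂ) :=
  LinearMap.mulLeft ℂ (fourier 1) ∘ₗ (Polynomial.aeval (fourier 1 : C(𝕋, ℂ))).toLinearMap

lemma shiftedPoly_apply (p : Polynomial ℂ) (x : 𝕋) :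
    shiftedPoly p x = fourier 1 x * p.eval (AddCircle.toCircle x : ℂ) := by
  have h := Polynomial.aeval_algHom_apply (ContinuousMap.evalAlgHom ℂ ℂ x)
    (fourier 1 : C(𝕋, ℂ)) p
  have h' : (Polynomial.aeval (fourier 1 : C(𝕋, ℂ)) p) x =
      p.eval (AddCircle.toCircle x : ℂ) := by
    rw [← fourier_one, ← Polynomial.coe_aeval_eq_eval]
    exact h.symm
  rw [← h']
  rfl

/-- With p = uv balanced, ∫ ψ z p is the inner product of the conjugate of zv with H_ψ u.
Cauchy–Schwarz loses nothing: equal moduli make both squared L² norms equal to the L¹ norm of zp. -/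
lemma norm_pairing_shiftedPoly_le {ψ : L ∞} {ε : ℝ}
    (h : ∀ f ∈ hardy 2, ‖projHc (mulL ψ f)‖ ≤ ε * ‖f‖) (p : Polynomial ℂ) :
    ‖pairing ψ (contL 1 (shiftedPoly p))‖ ≤ ε * ‖contL 1 (shiftedPoly p)‖ := by
  obtain ⟨F, G, hF, hG, hFG⟩ := hasBalancedFactorization_polynomial p
  have hc {F : ℂ → ℂ} (hF : DiffContOnCl ℂ F (Metric.ball 0 1)) :
      Continuous fun x : 𝕋 => F (AddCircle.toCircle x) := by
    refine hF.continuousOn_ball.comp_continuous (by fun_prop) fun x => ?_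
    rw [mem_closedBall_zero_iff]
    exact (Circle.norm_coe _).le
  let u : C(𝕋, ℂ) := ⟨_, hc hF⟩
  let v : C(𝕋, ℂ) := ⟨_, hc hG⟩
  have huv (x : 𝕋) : p.eval (AddCircle.toCircle x : ℂ) = u x * v x ∧ ‖u x‖ = ‖v x‖ :=
    hFG _ (Circle.norm_coe _)
  have hz (x : 𝕋) : ‖fourier 1 x‖ = 1 := by rw [fourier_one, Circle.norm_coe]
  let w : C(𝕋, ℂ) := star (fourier 1 * v)
  have hu : contL 2 u ∈ hardy 2 := fun n hn => by
    rw [fourierCoeff_congr_ae (coeFn_contL 2 u)]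
    exact fourierCoeff_of_diffContOnCl hF hn
  -- The extra factor z makes zv vanish at the origin, so its conjugate has no constant term.
  have hw : contL 2 w ∈ (hardy 2)ᗮ := by
    refine mem_hardy_orthogonal.2 fun n hn => ?_
    rw [fourierCoeff_congr_ae (coeFn_contL 2 w)]
    have := fourierCoeff_conj (fun x => fourier 1 x * v x) n
    rw [fourierCoeff_fourier_mul] at this
    refine this.trans ?_
    rw [show (v : 𝕋 → ℂ) = fun x : 𝕋 => G (AddCircle.toCircle x) from rfl,
      fourierCoeff_of_diffContOnCl hG (by omega), map_zero]
  have h1 : pairing ψ (contL 1 (shiftedPoly p)) =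
      inner ℂ (contL 2 w) (projHc (mulL ψ (contL 2 u))) := by
    rw [projHc_apply, inner_sub_right, Submodule.inner_left_of_mem_orthogonal
      (Submodule.starProjection_apply_mem _ _) hw, sub_zero, pairing_contL, L2.inner_def]
    refine integral_congr_ae ?_
    filter_upwards [coeFn_contL 2 w, coeFn_mulL ψ (contL 2 u), coeFn_contL 2 u] with x h1 h2 h3
    rw [h1, h2, h3, shiftedPoly_apply, (huv x).1, RCLike.inner_apply']
    simp only [w, ContinuousMap.star_apply, ContinuousMap.mul_apply, RCLike.star_def,
      Complex.conj_conj]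
    ring
  have h2 : ‖contL 2 w‖ ^ 2 = ‖contL 1 (shiftedPoly p)‖ := by
    rw [norm_sq_contL_two, norm_contL_one]
    refine integral_congr_ae (Eventually.of_forall fun x => ?_)
    simp only [shiftedPoly_apply, (huv x).1, norm_mul, (huv x).2, hz, w, ContinuousMap.star_apply,
      ContinuousMap.mul_apply, norm_star]
    ring
  have h3 : ‖contL 2 u‖ ^ 2 = ‖contL 1 (shiftedPoly p)‖ := by
    rw [norm_sq_contL_two, norm_contL_one]
    refine integral_congr_ae (Eventually.of_forall fun x => ?_)
    simp only [shiftedPoly_apply, (huv x).1, norm_mul, (huv x).2, hz]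
    ring
  have h4 : ‖contL 2 w‖ = ‖contL 2 u‖ :=
    (sq_eq_sq₀ (norm_nonneg _) (norm_nonneg _)).1 (h2.trans h3.symm)
  calc _ ≤ ‖contL 2 w‖ * ‖projHc (mulL ψ (contL 2 u))‖ := by rw [h1]; exact norm_inner_le_norm _ _
    _ ≤ ‖contL 2 w‖ * (ε * ‖contL 2 u‖) := by gcongr; exact h _ hu
    _ = ε * ‖contL 1 (shiftedPoly p)‖ := by rw [h4, ← h3]; ring

/-- **Nehari's theorem**: the distance of `ψ` to `H^∞` is at most the norm of its Hankel
operator. -/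
theorem nehari {ψ : L ∞} {ε : ℝ} (hε : 0 ≤ ε)
    (h : ∀ f ∈ hardy 2, ‖projHc (mulL ψ f)‖ ≤ ε * ‖f‖) : ∃ g : L ∞, ‖g‖ ≤ ε ∧ ψ - g ∈ hardy ∞ := by
  let S : Submodule ℂ (L 1) := LinearMap.range ((contL 1).toLinearMap ∘ₗ shiftedPoly)
  have hS (p : Polynomial ℂ) : contL 1 (shiftedPoly p) ∈ S := ⟨p, rfl⟩
  -- Hahn–Banach from the span of z, z², …. A density for Λ pairs with these exactly as ψ does, so
  -- it has the same negative coefficients.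
  obtain ⟨Λ, hΛ, hΛn⟩ := exists_extension_norm_eq S (pairing ψ ∘L S.subtypeL)
  have hΛε : ‖Λ‖ ≤ ε := by
    rw [hΛn]
    refine ContinuousLinearMap.opNorm_le_bound _ hε ?_
    rintro ⟨_, p, rfl⟩
    exact norm_pairing_shiftedPoly_le h p
  obtain ⟨g, hg, hgΛ⟩ := exists_integral_eq_of_clm_L_one Λ
  refine ⟨g, hg.trans hΛε, fun n hn => ?_⟩
  rw [fourierCoeff_coeFn_sub, sub_eq_zero]
  obtain ⟨k, hk⟩ : ∃ k : ℕ, n = -(k + 1 : ℕ) := ⟨(-n - 1).toNat, by omega⟩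
  have hf : shiftedPoly (Polynomial.X ^ k) = (fourier (-n) : C(𝕋, ℂ)) := by
    ext x
    rw [shiftedPoly_apply, Polynomial.eval_pow, Polynomial.eval_X, fourier_one, fourier_apply, hk,
      neg_neg, AddCircle.toCircle_zsmul, zpow_natCast, Circle.coe_pow, pow_succ']
  have h1 := hΛ ⟨_, hS (Polynomial.X ^ k)⟩
  change Λ (contL 1 (shiftedPoly _)) = pairing ψ (contL 1 (shiftedPoly _)) at h1
  rw [hf, hgΛ, pairing_contL] at h1
  simp only [fourierCoeff, smul_eq_mul]
  simp only [mul_comm (fourier (-n) _)]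
  exact h1.symm

/-! ### Symbols of compact Hankel operators -/

lemma fourier_mem_hardy (p : ℝ≥0∞) [Fact (1 ≤ p)] {k : ℤ} (hk : 0 ≤ k) :
    contL p (fourier k) ∈ hardy p := fun n hn => by
  rw [fourierCoeff_contL_fourier, if_neg (by omega)]

/-- The operators `f ↦ (1 - P) (z^N f)`. -/
def shiftHc (N : ℕ) : L 2 →L[ℂ] L 2 := projHc ∘L mulL (contL ∞ (fourier N))

lemma norm_shiftHc_le (N : ℕ) (f : L 2) : ‖shiftHc N f‖ ≤ ‖f‖ := by
  refine (norm_projHc_le _).trans ((norm_mulL_apply_le _ _).trans ?_)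
  refine mul_le_of_le_one_left (norm_nonneg _) ((norm_contL_le _ _).trans ?_)
  rw [fourier_norm]

/-- A trigonometric polynomial is moved into H² by a large power of z; density and contractivity do
the rest. -/
lemma exists_forall_shiftHc_lt (f : L 2) {ε : ℝ} (hε : 0 < ε) :
    ∃ N₀ : ℕ, ∀ N ≥ N₀, ‖shiftHc N f‖ < ε := by
  have hf : f ∈ (Submodule.span ℂ (Set.range (fourierLp (T := 2 * Real.pi) 2))).topologicalClosure := by
    rw [span_fourierLp_closure_eq_top (by simp)]
    trivial
  obtain ⟨p, hp, hfp⟩ := Metric.mem_closure_iff.1 hf ε hε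
  have h0 : ∃ N₀ : ℕ, ∀ N ≥ N₀, shiftHc N p = 0 := by
    clear hfp
    induction hp using Submodule.span_induction with
    | mem x hx =>
      obtain ⟨k, rfl⟩ := hx
      refine ⟨(-k).toNat, fun N hN => projHc_eq_zero fun n hn => ?_⟩
      refine (fourierCoeff_mulL_fourier (contL 2 (fourier k)) N n).trans ?_
      exact (fourierCoeff_contL_fourier 2 k _).trans (if_neg (by omega))
    | zero => exact ⟨0, fun N _ => map_zero _⟩
    | add x y _ _ hx hy =>
      obtain ⟨a, ha⟩ := hx
      obtain ⟨b, hb⟩ := hy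
      refine ⟨max a b, fun N hN => ?_⟩
      rw [map_add, ha N (le_of_max_le_left hN), hb N (le_of_max_le_right hN), add_zero]
    | smul c x _ hx =>
      obtain ⟨a, ha⟩ := hx
      exact ⟨a, fun N hN => by rw [map_smul, ha N hN, smul_zero]⟩
  obtain ⟨N₀, hN₀⟩ := h0
  refine ⟨N₀, fun N hN => ?_⟩
  rw [← sub_zero (shiftHc N f), ← hN₀ N hN, ← map_sub]
  refine (norm_shiftHc_le _ _).trans_lt ?_
  rwa [← dist_eq_norm]

/-- Strong convergence of contractions is uniform on the relatively compact image of the unit ball: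
use a finite ε/2-net. -/
lemma exists_norm_shiftHc_comp_le {H : L 2 →L[ℂ] L 2} (hH : IsCompactOperator H) {ε : ℝ}
    (hε : 0 < ε) : ∃ N : ℕ, ‖shiftHc N ∘L H‖ ≤ ε := by
  obtain ⟨K, hK, hKH⟩ := IsCompactOperator.image_closedBall_subset_compact
    (f := (H : L 2 →ₗ[ℂ] L 2)) hH 1
  obtain ⟨t, -, htf, hKt⟩ := hK.finite_cover_balls (half_pos hε)
  have h : ∃ N₀ : ℕ, ∀ N ≥ N₀, ∀ y ∈ t, ‖shiftHc N y‖ < ε / 2 := by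
    choose N hN using fun y : L 2 => exists_forall_shiftHc_lt y (half_pos hε)
    refine ⟨htf.toFinset.sup N, fun M hM y hy => hN y M ?_⟩
    exact (Finset.le_sup (htf.mem_toFinset.2 hy)).trans hM
  obtain ⟨N, hN⟩ := h
  refine ⟨N, ContinuousLinearMap.opNorm_le_of_unit_norm hε.le fun f hf => ?_⟩
  have hfK : H f ∈ K := hKH ⟨f, by simp [hf], rfl⟩
  obtain ⟨y, hy, hyf⟩ := Set.mem_iUnion₂.1 (hKt hfK)
  have h1 : shiftHc N (H f) = shiftHc N (H f - y) + shiftHc N y := by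
    rw [← map_add, sub_add_cancel]
  have h2 := norm_shiftHc_le N (H f - y)
  rw [mem_ball_iff_norm] at hyf
  have h3 := hN N le_rfl y hy
  calc _ ≤ ‖shiftHc N (H f - y)‖ + ‖shiftHc N y‖ := by
        rw [ContinuousLinearMap.comp_apply, h1]
        exact norm_add_le _ _
    _ ≤ ε := by linarith

lemma norm_mulInf_le (a b : L ∞) : ‖mulInf a b‖ ≤ ‖a‖ * ‖b‖ := by
  refine ((ContinuousLinearMap.mul ℂ ℂ).norm_holder_apply_apply_le a b).trans ?_
  gcongr
  simp

lemma fourierCoeff_mulInf_fourier (d : L ∞) (k n : ℤ) :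
    fourierCoeff (mulInf (contL ∞ (fourier k)) d : 𝕋 → ℂ) n =
      fourierCoeff (d : 𝕋 → ℂ) (n - k) := by
  rw [← fourierCoeff_fourier_mul]
  refine congrFun (fourierCoeff_congr_ae ?_) n
  filter_upwards [coeFn_mulInf (contL ∞ (fourier k)) d, coeFn_contL ∞ (fourier k)] with x h1 h2
  rw [h1, h2]

/-- Bounded functions with finitely many nonzero Fourier coefficients of negative index. -/
def finiteNeg : AddSubgroup (L ∞) where
  carrier := {d | ∃ N : ℤ, ∀ n < N, fourierCoeff (d : 𝕋 → ℂ) n = 0}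
  zero_mem' := ⟨0, (hardy ∞).zero_mem⟩
  add_mem' := by
    rintro a b ⟨M, hM⟩ ⟨N, hN⟩
    refine ⟨min M N, fun n hn => ?_⟩
    rw [fourierCoeff_coeFn_add, hM n (by omega), hN n (by omega), add_zero]
  neg_mem' := by
    rintro a ⟨M, hM⟩
    refine ⟨M, fun n hn => ?_⟩
    rw [← neg_one_smul ℂ a, fourierCoeff_coeFn_smul, hM n hn, mul_zero]

theorem mem_closure_finiteNeg {ψ : L ∞} (hψ : IsCompactOperator (hankel ψ)) :
    ψ ∈ finiteNeg.topologicalClosure := by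
  refine Metric.mem_closure_iff.2 fun ε hε => ?_
  obtain ⟨N, hN⟩ := exists_norm_shiftHc_comp_le hψ (half_pos hε)
  have h : ∀ f ∈ hardy 2, ‖projHc (mulL (mulInf (contL ∞ (fourier N)) ψ) f)‖ ≤ ε / 2 * ‖f‖ := by
    intro f hf
    -- Since z^N preserves H², inserting I - P after ψ changes nothing.
    have h1 : projHc (mulL (mulInf (contL ∞ (fourier N)) ψ) f) = (shiftHc N ∘L hankel ψ) f := by
      change _ = projHc (mulL _ (projHc (mulL ψ (projH f))))
      rw [mulL_mulInf, Submodule.starProjection_eq_self_iff.2 hf, projHc_apply (mulL ψ f), map_sub,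
        map_sub, projHc_eq_zero (f := mulL _ (projH _)), sub_zero]
      exact mulL_mem_hardy (fourier_mem_hardy ∞ (by positivity))
        (Submodule.starProjection_apply_mem _ _)
    rw [h1]
    exact ContinuousLinearMap.le_of_opNorm_le _ hN f
  obtain ⟨g, hg, hψg⟩ := nehari (half_pos hε).le h
  -- This approximant lies in z^{-N} H^∞ and differs from ψ by z^{-N} g, of norm at most ε/2.
  refine ⟨mulInf (contL ∞ (fourier (-N))) (mulInf (contL ∞ (fourier N)) ψ - g),
    ⟨-N, fun n hn => ?_⟩, ?_⟩
  · rw [fourierCoeff_mulInf_fourier]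
    exact hψg _ (by omega)
  · have h2 : ψ - mulInf (contL ∞ (fourier (-N))) (mulInf (contL ∞ (fourier N)) ψ - g) =
        mulInf (contL ∞ (fourier (-N))) g := by
      refine Lp.ext ?_
      filter_upwards [Lp.coeFn_sub ψ
          (mulInf (contL ∞ (fourier (-N))) (mulInf (contL ∞ (fourier N)) ψ - g)),
        coeFn_mulInf (contL ∞ (fourier (-N))) (mulInf (contL ∞ (fourier N)) ψ - g),
        Lp.coeFn_sub (mulInf (contL ∞ (fourier N)) ψ) g, coeFn_mulInf (contL ∞ (fourier N)) ψ,
        coeFn_mulInf (contL ∞ (fourier (-N))) g, coeFn_contL ∞ (fourier N),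
        coeFn_contL ∞ (fourier (-N))] with x h1 h2 h3 h4 h5 h6 h7
      rw [h1, Pi.sub_apply, h2, h3, Pi.sub_apply, h4, h5, h6, h7]
      have h8 : fourier (-N : ℤ) x * fourier (N : ℤ) x = 1 := by
        rw [← fourier_add, neg_add_cancel, fourier_zero]
      linear_combination (-ψ x) * h8
    rw [dist_eq_norm, h2]
    calc _ ≤ ‖contL ∞ (fourier (-N : ℤ))‖ * ‖g‖ := norm_mulInf_le _ _
      _ ≤ 1 * ‖g‖ := by
        gcongr
        exact (norm_contL_le _ _).trans (fourier_norm _).le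
      _ < ε := by linarith

/-! ### Fejér means -/

/-- The Fejér means of a function on the circle. -/
def fejer (M : ℕ) (d : 𝕋 → ℂ) : C(𝕋, ℂ) :=
  (M : ℂ)⁻¹ • ∑ j ∈ Finset.range M, ∑ l ∈ Finset.range M,
    fourierCoeff d (j - l : ℤ) • fourier (j - l : ℤ)

/-- The Fejér kernel. -/
def fejerKernel (M : ℕ) (x y : 𝕋) : ℝ :=
  (M : ℝ)⁻¹ * ‖∑ j ∈ Finset.range M, fourier (j : ℤ) x * fourier (-j : ℤ) y‖ ^ 2

lemma fejerKernel_nonneg (M : ℕ) (x y : 𝕋) : 0 ≤ fejerKernel M x y := by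
  unfold fejerKernel
  positivity

lemma continuous_fejerKernel (M : ℕ) (x : 𝕋) : Continuous (fejerKernel M x) := by
  unfold fejerKernel
  fun_prop

lemma ofReal_fejerKernel (M : ℕ) (x y : 𝕋) : (fejerKernel M x y : ℂ) =
    (M : ℂ)⁻¹ * ∑ j ∈ Finset.range M, ∑ l ∈ Finset.range M,
      fourier (j - l : ℤ) x * fourier (-(j - l) : ℤ) y := by
  rw [fejerKernel, Complex.ofReal_mul, Complex.ofReal_inv, Complex.ofReal_natCast,
    Complex.ofReal_pow, ← Complex.mul_conj', map_sum, Finset.sum_mul_sum]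
  congr 1
  refine Finset.sum_congr rfl fun j _ => Finset.sum_congr rfl fun l _ => ?_
  rw [map_mul, ← fourier_neg, ← fourier_neg, sub_eq_add_neg, fourier_add, neg_add, fourier_add]
  ring

lemma fejer_apply (M : ℕ) {d : 𝕋 → ℂ} (hd : Integrable d m) (x : 𝕋) :
    fejer M d x = ∫ y, (fejerKernel M x y : ℂ) * d y ∂m := by
  have h (y : 𝕋) : (fejerKernel M x y : ℂ) * d y = (M : ℂ)⁻¹ * ∑ j ∈ Finset.range M,
      ∑ l ∈ Finset.range M, fourier (j - l : ℤ) x * (fourier (-(j - l) : ℤ) y • d y) := by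
    rw [ofReal_fejerKernel, mul_assoc, Finset.sum_mul]
    simp only [Finset.sum_mul, smul_eq_mul, mul_assoc]
  have hint (n : ℤ) (c : ℂ) : Integrable (fun y => c * (fourier n y • d y)) m :=
    (hd.fourier_smul n).const_mul c
  simp_rw [h]
  rw [integral_const_mul, integral_finsetSum _ fun j _ => integrable_finsetSum _ fun l _ => hint _ _]
  simp_rw [integral_finsetSum _ fun l _ => hint _ _, integral_const_mul]
  simp only [fejer, ContinuousMap.smul_apply, ContinuousMap.sum_apply, smul_eq_mul]
  congr 1
  refine Finset.sum_congr rfl fun j _ => Finset.sum_congr rfl fun l _ => ?_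
  rw [mul_comm]
  rfl

lemma integral_fejerKernel {M : ℕ} (hM : M ≠ 0) (x : 𝕋) : ∫ y, fejerKernel M x y ∂m = 1 := by
  have h := fejer_apply M (integrable_const (1 : ℂ)) x
  simp only [mul_one] at h
  rw [integral_complex_ofReal] at h
  have h1 (n : ℤ) : fourierCoeff (fun _ : 𝕋 => (1 : ℂ)) n = if n = 0 then 1 else 0 := by
    have := fourierCoeff_fourier (T := 2 * Real.pi) 0
    have h0 : ((fourier 0 : C(𝕋, ℂ)) : 𝕋 → ℂ) = fun _ => 1 := by
      ext x
      exact fourier_zero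
    rw [h0] at this
    rw [this]
    simp [Pi.single_apply]
  have h2 : fejer M (fun _ => (1 : ℂ)) x = 1 := by
    have hM' : (M : ℂ) ≠ 0 := by exact_mod_cast hM
    simp only [fejer, ContinuousMap.smul_apply, ContinuousMap.sum_apply, smul_eq_mul, h1]
    rw [inv_mul_eq_one₀ hM']
    have h3 : ∀ j ∈ Finset.range M, ∑ l ∈ Finset.range M,
        (if (j - l : ℤ) = 0 then (1 : ℂ) else 0) * fourier (j - l : ℤ) x = 1 := by
      intro j hj
      rw [Finset.sum_eq_single_of_mem j hj]
      · simp
      · intro l _ hl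
        rw [if_neg (by omega), zero_mul]
    rw [Finset.sum_congr rfl h3]
    simp
  rw [h2] at h
  exact_mod_cast h.symm

/-- The Fejér kernel is a probability density. -/
lemma norm_fejer_le {M : ℕ} (hM : M ≠ 0) (d : L ∞) : ‖fejer M d‖ ≤ ‖d‖ := by
  refine (ContinuousMap.norm_le _ (norm_nonneg _)).2 fun x => ?_
  rw [fejer_apply M (integrable_of_L le_top d)]
  refine (norm_integral_le_integral_norm _).trans ?_
  have hk : Integrable (fejerKernel M x) m :=
    (ContinuousMap.memLp m ℝ (p := 1) ⟨_, continuous_fejerKernel M x⟩).integrable le_rfl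
  calc _ ≤ ∫ y, fejerKernel M x y * ‖d‖ ∂m := by
        refine integral_mono_of_nonneg (Eventually.of_forall fun y => norm_nonneg _)
          (hk.mul_const _) ?_
        filter_upwards [ae_le_eLpNormEssSup (f := (d : 𝕋 → ℂ)) (μ := m)] with y hy
        have hy' : ‖d y‖ ≤ ‖d‖ := by
          rw [Lp.norm_def, eLpNorm_exponent_top, ← toReal_enorm]
          refine ENNReal.toReal_mono ?_ hy
          rw [← eLpNorm_exponent_top]
          exact Lp.eLpNorm_ne_top d
        rw [norm_mul, Complex.norm_real, Real.norm_of_nonneg (fejerKernel_nonneg _ _ _)]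
        gcongr
        exact fejerKernel_nonneg _ _ _
    _ = ‖d‖ := by rw [integral_mul_const, integral_fejerKernel hM, one_mul]

/-- The Fourier multiplier of the Fejér means. -/
def fejerWeight (M : ℕ) (n : ℤ) : ℂ :=
  (M : ℂ)⁻¹ * ∑ j ∈ Finset.range M, ∑ l ∈ Finset.range M, if n = (j - l : ℤ) then 1 else 0

lemma fourierCoeff_fejer (M : ℕ) (d : 𝕋 → ℂ) (n : ℤ) :
    fourierCoeff (contL ∞ (fejer M d) : 𝕋 → ℂ) n = fejerWeight M n * fourierCoeff d n := by
  change coeffₗ ∞ n (contL ∞ (fejer M d)) = _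
  simp only [fejer, map_smul, map_sum, fejerWeight, smul_eq_mul, mul_assoc, Finset.sum_mul]
  congr 1
  refine Finset.sum_congr rfl fun j _ => Finset.sum_congr rfl fun l _ => ?_
  change fourierCoeff d _ * fourierCoeff (contL ∞ (fourier _) : 𝕋 → ℂ) n = _
  rw [fourierCoeff_contL_fourier]
  split_ifs with h
  · rw [h, mul_comm]
  · simp

/-- Counting the pairs with j - l = -k gives the weight 1 - k/M once M > k. -/
lemma tendsto_fejerWeight {n : ℤ} (hn : n < 0) :
    Tendsto (fun M => fejerWeight M n) atTop (𝓝 1) := by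
  obtain ⟨k, rfl⟩ : ∃ k : ℕ, n = -k := ⟨(-n).toNat, by omega⟩
  have h1 : Tendsto (fun M : ℕ => 1 - (k : ℂ) / M) atTop (𝓝 1) := by
    simpa using (tendsto_const_div_atTop_nhds_zero_nat (k : ℂ)).const_sub 1
  refine h1.congr' ?_
  filter_upwards [eventually_ge_atTop (k + 1)] with M hM
  have hM' : (M : ℂ) ≠ 0 := by exact_mod_cast (by omega : M ≠ 0)
  have h2 : ∀ j ∈ Finset.range M, (∑ l ∈ Finset.range M,
      if (-k : ℤ) = (j - l : ℤ) then (1 : ℂ) else 0) = if j ∈ Finset.range (M - k) then 1 else 0 := by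
    intro j hj
    have h3 : ∀ l ∈ Finset.range M, (if (-k : ℤ) = (j - l : ℤ) then (1 : ℂ) else 0) =
        if j + k = l then 1 else 0 := fun l _ => by
      congr 1
      exact propext ⟨fun h => by omega, fun h => by omega⟩
    rw [Finset.sum_congr rfl h3, Finset.sum_ite_eq]
    congr 1
    simp only [Finset.mem_range]
    exact propext ⟨fun h => by omega, fun h => by omega⟩
  rw [fejerWeight, Finset.sum_congr rfl h2, Finset.sum_ite_mem,
    Finset.inter_eq_right.2 (Finset.range_mono (Nat.sub_le M k)), Finset.sum_const,
    Finset.card_range, nsmul_eq_mul, Nat.cast_sub (by omega)]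
  field_simp

/-! ### Closedness of C(𝕋) + H^∞ and Hartman's theorem -/

lemma norm_trigPoly_le (s : Finset ℤ) (a : ℤ → ℂ) : ‖trigPoly s a‖ ≤ ∑ j ∈ s, ‖a j‖ := by
  refine (norm_sum_le _ _).trans (Finset.sum_le_sum fun j _ => ?_)
  rw [norm_smul, fourier_norm, mul_one]

/-- What matters is the constant 3, independent of how many negative coefficients d has. -/
lemma exists_cont_add_hardy {d : L ∞} (hd : d ∈ finiteNeg) :
    ∃ c : C(𝕋, ℂ), ∃ h ∈ hardy ∞, contL ∞ c + h = d ∧ ‖c‖ ≤ 3 * ‖d‖ ∧ ‖h‖ ≤ 3 * ‖d‖ := by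
  rcases eq_or_ne d 0 with rfl | hd0
  · exact ⟨0, 0, zero_mem _, by simp, by simp, by simp⟩
  obtain ⟨N, hN⟩ := hd
  let a (M : ℕ) (n : ℤ) : ℂ := (1 - fejerWeight M n) * fourierCoeff (d : 𝕋 → ℂ) n
  have ha : Tendsto (fun M => ∑ n ∈ Finset.Ico N 0, ‖a M n‖) atTop (𝓝 0) := by
    have : Tendsto (fun M => ∑ n ∈ Finset.Ico N 0, ‖a M n‖) atTop
        (𝓝 (∑ n ∈ Finset.Ico N 0, (0 : ℝ))) := by
      refine tendsto_finsetSum _ fun n hn => ?_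
      have h := (((tendsto_fejerWeight (Finset.mem_Ico.1 hn).2).const_sub 1).mul_const
        (fourierCoeff (d : 𝕋 → ℂ) n)).norm
      simpa [a] using h
    simpa using this
  -- M is so large that the correction has norm below ‖d‖, whence the separate case d = 0. The
  -- corrected mean c has the negative coefficients of d and norm at most 2‖d‖.
  obtain ⟨M, hM, hM0⟩ := ((ha.eventually (gt_mem_nhds (norm_pos_iff.2 hd0))).and
    (eventually_ge_atTop 1)).exists
  let c := fejer M d + trigPoly (Finset.Ico N 0) (a M)
  have hc : ‖c‖ ≤ 2 * ‖d‖ := by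
    refine (norm_add_le _ _).trans ?_
    have h1 := norm_fejer_le (by omega : M ≠ 0) d
    have h2 := norm_trigPoly_le (Finset.Ico N 0) (a M)
    linarith
  refine ⟨c, d - contL ∞ c, fun n hn => ?_, by abel, ?_, ?_⟩
  · rw [fourierCoeff_coeFn_sub, map_add, fourierCoeff_coeFn_add, fourierCoeff_fejer,
      fourierCoeff_trigPoly]
    split_ifs with hs
    · simp only [a]
      ring
    · rw [hN n (by simp at hs; omega)]
      ring
  · linarith [norm_nonneg d]
  · refine (norm_sub_le _ _).trans ?_
    linarith [norm_contL_le ∞ c]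

lemma isClosed_hardy_top : IsClosed (hardy ∞ : Set (L ∞)) := by
  have h : (hardy ∞ : Set (L ∞)) = ⋂ n : ℤ, ⋂ _ : n < 0, {f : L ∞ |
      ((ContinuousLinearMap.mul ℂ ℂ).lpPairing m ∞ 1).flip (contL 1 (fourier (-n))) f = 0} := by
    ext f
    simp only [SetLike.mem_coe, mem_hardy, Set.mem_iInter, Set.mem_ofPred_eq]
    refine forall₂_congr fun n _ => ?_
    have : ((ContinuousLinearMap.mul ℂ ℂ).lpPairing m ∞ 1).flip (contL 1 (fourier (-n))) f =
        fourierCoeff (f : 𝕋 → ℂ) n := by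
      refine (pairing_contL f _).trans (integral_congr_ae (Eventually.of_forall fun x => ?_))
      exact mul_comm _ _
    rw [this]
  rw [h]
  exact isClosed_iInter fun n => isClosed_iInter fun _ =>
    isClosed_eq (ContinuousLinearMap.continuous _) continuous_const

instance : CompleteSpace (hardy ∞) := isClosed_hardy_top.completeSpace_coe

/-- Preimages under (c, h) ↦ c + h with uniform norm control on a subgroup extend, by summing a
series in a complete space, to its closure. -/
theorem exists_cont_add_hardy_of_mem_closure {ψ : L ∞} (hψ : ψ ∈ finiteNeg.topologicalClosure) :
    ∃ c : C(𝕋, ℂ), ∃ h ∈ hardy ∞, ψ = contL ∞ c + h := by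
  let F : C(𝕋, ℂ) × hardy ∞ →L[ℂ] L ∞ := (contL ∞).coprod (hardy ∞).subtypeL
  let f : NormedAddGroupHom (C(𝕋, ℂ) × hardy ∞) (L ∞) :=
    (F : C(𝕋, ℂ) × hardy ∞ →+ L ∞).mkNormedAddGroupHom ‖F‖ F.le_opNorm
  have hf : f.SurjectiveOnWith finiteNeg 3 := by
    intro d hd
    obtain ⟨c, h, hh, hch, hc, hhd⟩ := exists_cont_add_hardy hd
    exact ⟨(c, ⟨h, hh⟩), hch, max_le hc hhd⟩
  -- Here 1 is the slack allowed on the constant 3; only existence is used.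
  obtain ⟨⟨c, h⟩, hch, -⟩ := controlled_closure_of_complete three_pos one_pos hf ψ hψ
  exact ⟨c, h, h.2, hch.symm⟩

/-- **Hartman's theorem**: a bounded symbol with compact Hankel operator belongs to
`C(𝕋) + H^∞`. -/
theorem hartman {ψ : L ∞} (hψ : IsCompactOperator (hankel ψ)) :
    ∃ c : C(𝕋, ℂ), ∃ h ∈ hardy ∞, ψ = contL ∞ c + h :=
  exists_cont_add_hardy_of_mem_closure (mem_closure_finiteNeg hψ)

lemma coeFn_contL_add (c : C(𝕋, ℂ)) (h : L ∞) :
    ((contL ∞ c + h : L ∞) : 𝕋 → ℂ) =ᵐ[m] fun x => c x + h x := by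
  filter_upwards [Lp.coeFn_add (contL ∞ c) h, coeFn_contL ∞ c] with x h1 h2
  rw [h1, Pi.add_apply, h2]

end TTO

end

/-! ### The main theorem -/

theorem mainTheorem6 (Θ : ℂ → ℂ) (hΘ : TTO.IsInner Θ) (φ : TTO.L 2) :
    (φ ∈ TTO.innerMulContAddHInf Θ → TTO.ExtendsCompactly (TTO.tto Θ φ)) ∧
    (φ ∈ TTO.contAddHInf → TTO.ExtendsCompactly (TTO.tto Θ φ) →
      φ ∈ TTO.innerMulContAddHInf Θ) := by
  obtain ⟨T, hT⟩ := TTO.exists_isInnerBoundary hΘ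
  constructor
  · rintro ⟨c, h, hh, hφ⟩
    refine (TTO.extendsCompactly_tto_iff hT (Φ := TTO.mulInf T (TTO.contL ∞ c + h)) ?_).2
      (TTO.isCompactOperator_boundedTTO hT c hh)
    filter_upwards [hφ, TTO.coeFn_mulInf T (TTO.contL ∞ c + h), TTO.coeFn_contL_add c h,
      hT.eq_boundary] with x h1 h2 h3 h4
    rw [h1, h2, h3, h4, mul_add]
  · rintro ⟨c, h, hh, hφ⟩ hA
    have hΦ : (φ : TTO.𝕋 → ℂ) =ᵐ[TTO.m] (TTO.contL ∞ c + h : TTO.L ∞) :=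
      hφ.trans (TTO.coeFn_contL_add c h).symm
    obtain ⟨c', h', hh', he⟩ := TTO.hartman (TTO.isCompactOperator_hankel_star_mul hT c hh
      ((TTO.extendsCompactly_tto_iff hT hΦ).1 hA))
    refine ⟨c', h', hh', ?_⟩
    have h0 := TTO.coeFn_mulInf (star T) (TTO.contL ∞ c + h)
    rw [he] at h0
    filter_upwards [hΦ, h0, TTO.coeFn_contL_add c' h', hT.eq_boundary, hT.norm_eq,
      Lp.coeFn_star T] with x h1 h2 h3 h4 h5 h6
    -- Hartman gives T̄φ = c' + h'; multiplying by T and using |T| = 1 recovers φ.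
    rw [h4, ← mul_add, ← h3, h2, h6, Pi.star_apply, ← mul_assoc, RCLike.star_def, RCLike.mul_conj,
      h5, h1]
    simp
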